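/- Let $p$ be an odd prime, let $\zeta$ be a primitive $p$-th root of unity, $K=\mathbb{Q}(\zeta)$ with ring of integers $O_K$, and $\pi=(1-\zeta)O_K$. Let $K^+=\mathbb{Q}(\zeta+\zeta^{-1})$, with ring of integers $O_{K^+}$ and unit group $O_{K^+}^*$. Let $u$ be a primitive root modulo $p$, let $\sigma$ be the automorphism of $K$ with $\sigma(\zeta)=\zeta^u$, and for a natural number $i$ let $u_i$ be the integer with $u_i\equiv u^i \pmod p$ and $1\le u_i\le p-1$. An element $B\in O_K$ is called singular if $B$ is not a $p$-th power in $K$ and $BO_K=\mathbf{b}^p$ for some ideal $\mathbf{b}$ of $O_K$. A singular $B$ is called primary if $B\equiv c^p \pmod{\pi^p}$ for some $c\in\mathbb{Z}$ with $c\not\equiv 0\pmod p$, and non-primary otherwise. Let $m$ be a natural number with $1\le m\le \frac{p-3}{2}$ and put $\mu=u_{2m}$. Then there exists a singular unit $\eta\in O_{K^+}^*$ such that $\sigma(\eta)=\eta^{\mu}\varepsilon^p$ for some $\varepsilon\in O_{K^+}^*$. Moreover, for every singular unit $\eta\in O_{K^+}^*$ satisfying such a relation, if $\eta$ is non-primary,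 then $\pi^{2m}$ exactly divides $\eta^{p-1}-1$, that is, $\pi^{2m}$ divides $\eta^{p-1}-1$ and $\pi^{2m+1}$ does not. -/

import Mathlib

open NumberField

/-- The subfield `K⁺ = ℚ(ζ + ζ⁻¹)` of `K`. -/
abbrev RealSubfield {K : Type*} [Field K] [NumberField K] (ζ : K) : IntermediateField ℚ K :=
  IntermediateField.adjoin ℚ {ζ + ζ⁻¹}

/-- The ideal `π = (1 - ζ) O_K`, for a primitive `p`-th root of unity `ζ` of `K`. -/
def primePi {p : ℕ} [Fact p.Prime] {K : Type*} [Field K] [NumberField K] {ζ : K}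
    (hζ : IsPrimitiveRoot ζ p) : Ideal (𝓞 K) :=
  haveI : NeZero p := ⟨(Fact.out : p.Prime).ne_zero⟩
  Ideal.span {1 - hζ.toInteger}

/-- `u_i`: the residue of `u ^ i` modulo `p`. When the prime `p` does not divide `u`, it lies
between `1` and `p - 1`. -/
def powResidue (p u i : ℕ) : ℕ := u ^ i % p

/-- `B` is a singular integer: it has no `p`-th root in `K`, and the ideal `B O_K` is the
`p`-th power of an ideal. -/
def IsSingular (p : ℕ) {K : Type*} [Field K] [NumberField K] (B : 𝓞 K) : Prop :=
  (¬ ∃ x : K, x ^ p = (B : K)) ∧ ∃ b : Ideal (𝓞 K), Ideal.span {B} = b ^ p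

/-- `B` is singular primary: it is singular and `B ≡ c ^ p mod π ^ p` for a rational integer `c`
not divisible by `p`. -/
def IsSingularPrimary {p : ℕ} [Fact p.Prime] {K : Type*} [Field K] [NumberField K] {ζ : K}
    (hζ : IsPrimitiveRoot ζ p) (B : 𝓞 K) : Prop :=
  IsSingular p B ∧ ∃ c : ℤ, ¬ (p : ℤ) ∣ c ∧ B - (c : 𝓞 K) ^ p ∈ primePi hζ ^ p

/-- `I ^ n ‖ a`: the ideal `I ^ n` divides `a`, and `I ^ (n + 1)` does not. -/
def ExactlyDivides {R : Type*} [CommRing R] (I : Ideal R) (n : ℕ) (a : R) : Prop :=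
  I ^ n ∣ Ideal.span {a} ∧ ¬ I ^ (n + 1) ∣ Ideal.span {a}

/-- The unit `η` of `O_{K⁺}` satisfies `σ(η) = η ^ μ * ε ^ p` for some unit `ε` of `O_{K⁺}`. -/
def IsEigenUnit (p : ℕ) {K : Type*} [Field K] [NumberField K] (ζ : K) (σ : K ≃ₐ[ℚ] K) (μ : ℕ)
    (η : (𝓞 (RealSubfield ζ))ˣ) : Prop :=
  ∃ ε : (𝓞 (RealSubfield ζ))ˣ,
    σ (algebraMap (𝓞 (RealSubfield ζ)) K η) =
      algebraMap (𝓞 (RealSubfield ζ)) K η ^ μ * algebraMap (𝓞 (RealSubfield ζ)) K ε ^ p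

/-! Existence. Let `n = (p - 1) / 2`. On the units of `K⁺`, `σ` acts with `σ ^ n = 1`, and `μ ≡ u ^
(2m)` is an `n`-th root of unity modulo `p` other than `1`. A Dirichlet unit made real has
conjugates whose only relations come from the norm
(`exists_unit_realSubfield_independent_conjugates`). By `Module.End.exists_eigenvector_mod_prime`
this forces every such root of unity to be an eigenvalue on units modulo `p`-th powers. An
eigenvector is not a `p`-th power in `K⁺`, hence not in `K`, so it is singular.

Valuation. Put `X = η ^ (p - 1)`. Since `ε ^ (p - 1) ≡ 1` modulo `π`, its `p`-th power is `1` modulo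
`π ^ p`, so `σ X ≡ X ^ μ` modulo `π ^ p`. On `π ^ v / π ^ (v + 1)` the map `σ` is multiplication by
`u ^ v`, so for `v < p` the valuation of `X - 1` can equal `v` only if `u ^ v ≡ u ^ (2m)`, that is,
`v = 2m`. Otherwise `X ≡ 1` modulo `π ^ p`, whence `η ≡ η ^ p ≡ c ^ p` and `η` is primary. -/

/-! ### Linear algebra: eigenvectors modulo `p`, and relations between shifts. -/

/-- If `W` is a submodule of a finitely generated abelian group, the elements having a nonzero
multiple in `W` have a common such multiple. -/
theorem Submodule.exists_common_smul_mem {M : Type*} [AddCommGroup M] [Module.Finite ℤ M]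
    (W : Submodule ℤ M) :
    ∃ n : ℤ, n ≠ 0 ∧ ∀ x : M, ∀ k : ℤ, k ≠ 0 → k • x ∈ W → n • x ∈ W := by
  let T := Submodule.torsion ℤ (M ⧸ W)
  have hfin : Finite T := Module.finite_of_fg_torsion T (Submodule.torsion_isTorsion)
  refine ⟨Nat.card T, by exact_mod_cast Nat.card_pos.ne', fun x k hk hx => ?_⟩
  have hxT : W.mkQ x ∈ T := by
    refine ⟨⟨k, mem_nonZeroDivisors_of_ne_zero hk⟩, ?_⟩
    change k • W.mkQ x = 0
    rw [← map_smul]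
    exact (Submodule.Quotient.mk_eq_zero W).mpr hx
  have h0 : Nat.card T • (⟨W.mkQ x, hxT⟩ : T) = 0 := card_nsmul_eq_zero'
  have h1 : Nat.card T • W.mkQ x = 0 := by simpa using congrArg Subtype.val h0
  rw [← map_nsmul] at h1
  rw [natCast_zsmul]
  exact (Submodule.Quotient.mk_eq_zero W).mp h1

/-- Let `S` be an endomorphism with `S ^ n = 1` of a finitely generated abelian group without
`p`-torsion, and suppose that the only relations between `v, S v, …, S ^ (n - 1) v` are the
multiples of their sum. Then every `n`-th root of unity `b ≠ 1` modulo `p` is an eigenvalue of `S`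
modulo `p`. -/
theorem Module.End.exists_eigenvector_mod_prime {M : Type*} [AddCommGroup M] [Module.Finite ℤ M]
    {p : ℕ} (hp : p.Prime) (hM : ∀ x : M, (p : ℤ) • x = 0 → x = 0)
    (S : Module.End ℤ M) {n : ℕ} (hn : 2 ≤ n) (hS : S ^ n = 1) (v : M)
    (hv : ∀ c : ℕ → ℤ, ∑ i ∈ Finset.range n, c i • (S ^ i) v = 0 →
      ∀ i < n, ∀ j < n, c i = c j)
    (b : ℤ) (hb : (p : ℤ) ∣ b ^ n - 1) (hb1 : ¬ (p : ℤ) ∣ b - 1) :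
    ∃ x : M, (¬ ∃ y, x = (p : ℤ) • y) ∧ ∃ y, S x = b • x + (p : ℤ) • y := by
  by_contra! hcon
  have hker : ∀ x y : M, S x = b • x + (p : ℤ) • y → ∃ z, x = (p : ℤ) • z := by
    intro x y h
    by_contra! hx
    exact hcon x hx y h
  obtain ⟨d, hd0, hd⟩ := (Submodule.span ℤ
    (Set.range fun i : Fin n => (S ^ (i : ℕ)) v)).exists_common_smul_mem
  have hbpow : ∀ N : ℕ, (p : ℤ) ∣ b ^ p ^ N - b := by
    have := Fact.mk hp
    intro N
    rw [← ZMod.intCast_zmod_eq_zero_iff_dvd]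
    push_cast
    rw [ZMod.pow_card_pow, sub_self]
  have key : ∀ N : ℕ, (p : ℤ) ^ N ∣ d * (1 - b ^ p ^ N) := by
    intro N
    -- An approximate Teichmüller lift: `a ≡ b` modulo `p`, while `a ^ n ≡ 1` modulo `p ^ N`.
    set a := b ^ p ^ N with ha
    -- Injectivity of `S - a` modulo `p` lifts to every `p ^ k`, since a factor `p` can be cancelled
    -- in `M`.
    have hker_pow : ∀ k : ℕ, ∀ x y : M, S x - a • x = (p : ℤ) ^ k • y →
        ∃ z, x = (p : ℤ) ^ k • z := by
      intro k
      induction k with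
      | zero => intro x y _; exact ⟨x, by simp⟩
      | succ k ih =>
        intro x y h
        obtain ⟨t, ht⟩ := hbpow N
        obtain ⟨z, rfl⟩ := hker x (t • x + (p : ℤ) ^ k • y) (by
          have : S x = a • x + (p : ℤ) ^ (k + 1) • y := by rw [← h]; abel
          rw [this, ha, show b ^ p ^ N = b + p * t by rw [← ht]; ring]
          module)
        obtain ⟨w, rfl⟩ := ih z y (by
          rw [← sub_eq_zero]
          apply hM
          rw [map_smul] at h
          rw [show (p : ℤ) • (S z - a • z - (p : ℤ) ^ k • y) =
            (p : ℤ) • S z - a • (p : ℤ) • z - (p : ℤ) ^ (k + 1) • y by module, h, sub_self])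
        exact ⟨w, by module⟩
    set g : M := ∑ i ∈ Finset.range n, a ^ (n - 1 - i) • (S ^ i) v with hg
    have hSg : S g - a • g = (1 - a ^ n) • v := by
      have hc : Commute S (algebraMap ℤ (Module.End ℤ M) a) := (Algebra.commutes a S).symm
      have h := congrArg (fun f : Module.End ℤ M => f v) (hc.mul_geom_sum₂ n)
      simp only [hS, ← map_pow, Module.End.mul_apply, LinearMap.sub_apply, LinearMap.sum_apply,
        Module.algebraMap_end_apply, Module.End.one_apply] at h
      have h2 : ∑ i ∈ Finset.range n, (S ^ i) (a ^ (n - 1 - i) • v) = g := by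
        simp [hg]
      rw [h2] at h
      rw [h]; module
    have han : (p : ℤ) ^ N ∣ 1 - a ^ n := by
      have := dvd_sub_pow_of_dvd_sub hb N
      rw [one_pow, ← pow_mul, mul_comm, pow_mul] at this
      rw [← dvd_neg, neg_sub]
      exact (pow_dvd_pow _ N.le_succ).trans this
    obtain ⟨t, ht⟩ := han
    obtain ⟨z, hz⟩ := hker_pow N g (t • v) (by rw [hSg, ht]; module)
    have hpN : (p : ℤ) ^ N ≠ 0 := pow_ne_zero _ (by exact_mod_cast hp.ne_zero)
    have hzW := hd z _ hpN (by
      rw [← hz]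
      refine Submodule.sum_mem _ fun i hi => Submodule.smul_mem _ _ (Submodule.subset_span ?_)
      exact ⟨⟨i, Finset.mem_range.mp hi⟩, rfl⟩)
    obtain ⟨e, he⟩ := (Submodule.mem_span_range_iff_exists_fun ℤ).mp hzW
    -- The relation is `d • g = p ^ N • (d • z)` written in the `S ^ i v`. Comparing its last two
    -- coefficients gives `p ^ N ∣ d * (1 - a)`.
    have hrel := hv (fun i => d * a ^ (n - 1 - i) -
        (p : ℤ) ^ N * if h : i < n then e ⟨i, h⟩ else 0) (by
      simp only [sub_smul, Finset.sum_sub_distrib, mul_smul, ← Finset.smul_sum]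
      rw [← hg, hz, Finset.sum_range, smul_comm, ← smul_sub, ← he]
      simp) (n - 1) (by omega) (n - 2) (by omega)
    simp only [show n - 1 - (n - 2) = 1 by omega, Nat.sub_self, pow_zero, pow_one] at hrel
    rw [show d * (1 - a) = d * 1 - d * a by ring]
    exact ⟨(if h : n - 1 < n then e ⟨n - 1, h⟩ else 0) -
      (if h : n - 2 < n then e ⟨n - 2, h⟩ else 0), by linear_combination hrel⟩
  have hpd : ∀ N : ℕ, (p : ℤ) ^ N ∣ d := by
    intro N
    refine IsCoprime.dvd_of_dvd_mul_right ?_ (key N)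
    refine IsCoprime.pow_left ?_
    rw [(Nat.prime_iff_prime_int.mp hp).coprime_iff_not_dvd]
    intro h
    apply hb1
    have := dvd_add (hbpow N) h
    rw [← dvd_neg]
    convert this using 1
    ring
  obtain ⟨N, hN⟩ := pow_unbounded_of_one_lt |d| (show (1 : ℤ) < p by exact_mod_cast hp.one_lt)
  exact absurd (Int.le_of_dvd (abs_pos.mpr hd0) ((dvd_abs _ _).mpr (hpd N))) (not_le.mpr hN)

/-- If a periodic real sequence has sum zero over a period and is negative off the multiples of the
period, then the only relations between its shifts are the multiples of their sum. -/
theorem eq_of_sum_mul_shift_eq_zero {n : ℕ} (f : ZMod n → ℝ) [NeZero n]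
    (hf : ∀ i, i ≠ 0 → f i < 0) (hsum : ∑ i, f i = 0) (c : ZMod n → ℝ)
    (hc : ∀ j, ∑ i, c i * f (i + j) = 0) (i j : ZMod n) : c i = c j := by
  obtain ⟨k, hk⟩ := Finite.exists_max c
  suffices h : ∀ i, c i = c k by rw [h i, h j]
  intro i
  -- Maximum principle: with `c k` maximal, every term of this sum is nonnegative, so every term
  -- vanishes.
  have h0 : ∑ i, (c i - c k) * f (i + -k) = 0 := by
    simp only [sub_mul, Finset.sum_sub_distrib, hc, ← Finset.mul_sum]
    rw [Fintype.sum_equiv (Equiv.addRight (-k)) (fun i => f (i + -k)) f (fun _ => rfl), hsum]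
    simp
  have hnn : ∀ i ∈ Finset.univ, 0 ≤ (c i - c k) * f (i + -k) := by
    intro i _
    by_cases hik : i = k
    · simp [hik]
    · refine mul_nonneg_of_nonpos_of_nonpos (sub_nonpos.mpr (hk i)) (hf _ ?_).le
      rwa [← sub_eq_add_neg, sub_ne_zero]
  have := (Finset.sum_eq_zero_iff_of_nonneg hnn).mp h0 i (Finset.mem_univ i)
  by_cases hik : i = k
  · rw [hik]
  · rcases mul_eq_zero.mp this with h | h
    · linarith
    · exact absurd h (hf _ (by rwa [← sub_eq_add_neg, sub_ne_zero])).ne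

/-! ### Galois action on the cyclotomic field and its real subfield. -/

theorem IsPrimitiveRoot.pow_eq_pow_iff_natCast {M : Type*} [CommMonoid M] {x : M} {k : ℕ} [NeZero k]
    (hx : IsPrimitiveRoot x k) (a b : ℕ) : x ^ a = x ^ b ↔ (a : ZMod k) = b := by
  rw [(hx.isOfFinOrder (NeZero.ne k)).pow_eq_pow_iff_modEq, ← hx.eq_orderOf,
    ZMod.natCast_eq_natCast_iff]

theorem IsPrimitiveRoot.algEquiv_ext {n : ℕ} {K : Type*} [Field K] [NumberField K]
    [IsCyclotomicExtension {n} ℚ K] {ζ : K} (hζ : IsPrimitiveRoot ζ n) {τ τ' : K ≃ₐ[ℚ] K}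
    (h : τ ζ = τ' ζ) : τ = τ' := by
  refine IsCyclotomicExtension.algEquiv_eq_of_apply_eq {n} ℚ K fun k hk _ => ⟨ζ, ?_, h⟩
  rwa [Set.mem_singleton_iff.mp hk]

theorem algEquiv_pow_apply_of_apply_eq_pow {F K : Type*} [Field F] [Field K] [Algebra F K]
    {σ : K ≃ₐ[F] K} {x : K} {u : ℕ} (hσ : σ x = x ^ u) (j : ℕ) : (σ ^ j) x = x ^ u ^ j := by
  induction j with
  | zero => simp
  | succ j ih => rw [pow_succ', AlgEquiv.mul_apply, ih, map_pow, hσ, ← pow_mul, ← pow_succ']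

/-- Since `u` has order `p - 1` modulo `p`, `u ^ ((p - 1) / 2) ≡ -1`; this power of `σ` serves as
complex conjugation throughout. -/
theorem IsPrimitiveRoot.algEquiv_pow_half_apply {p : ℕ} [Fact p.Prime] {F K : Type*} [Field F]
    [Field K] [Algebra F K] {ζ : K} (hζ : IsPrimitiveRoot ζ p) (hp2 : p ≠ 2) {u : ℕ}
    (hu : IsPrimitiveRoot (u : ZMod p) (p - 1)) {σ : K ≃ₐ[F] K} (hσ : σ ζ = ζ ^ u) :
    (σ ^ ((p - 1) / 2)) ζ = ζ⁻¹ := by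
  have hp := (Fact.out : p.Prime)
  have : NeZero p := ⟨hp.ne_zero⟩
  have hodd := hp.eq_two_or_odd'.resolve_left hp2
  obtain ⟨k, hk⟩ := hodd
  have hk0 : 0 < k := by have := hp.two_le; omega
  have hk2 : (p - 1) / 2 = k := by omega
  have hu1 : (u : ZMod p) ^ k = -1 := by
    have h1 : ((u : ZMod p) ^ k) ^ 2 = 1 := by
      rw [← pow_mul, show k * 2 = p - 1 by omega, hu.pow_eq_one]
    refine (sq_eq_sq_iff_eq_or_eq_neg.mp (h1.trans (one_pow 2).symm)).resolve_left ?_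
    exact hu.pow_ne_one_of_pos_of_lt hk0.ne' (by omega)
  rw [hk2, algEquiv_pow_apply_of_apply_eq_pow hσ]
  refine eq_inv_of_mul_eq_one_left ?_
  rw [← pow_succ, ← pow_zero ζ, hζ.pow_eq_pow_iff_natCast]
  push_cast
  rw [hu1]; ring

section CyclotomicGalois

variable {p : ℕ} [Fact p.Prime] {K : Type*} [Field K] [NumberField K]
  [IsCyclotomicExtension {p} ℚ K] {ζ : K}

theorem IsPrimitiveRoot.algEquiv_pow_eq_pow_iff (hζ : IsPrimitiveRoot ζ p) {u : ℕ}
    (hu : IsPrimitiveRoot (u : ZMod p) (p - 1)) {σ : K ≃ₐ[ℚ] K} (hσ : σ ζ = ζ ^ u) (i j : ℕ) :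
    σ ^ i = σ ^ j ↔ i ≡ j [MOD p - 1] := by
  have : NeZero (p - 1) := ⟨by have := (Fact.out : p.Prime).two_le; omega⟩
  have : NeZero p := ⟨(Fact.out : p.Prime).ne_zero⟩
  rw [← ZMod.natCast_eq_natCast_iff, ← hu.pow_eq_pow_iff_natCast, ← Nat.cast_pow, ← Nat.cast_pow,
    ← hζ.pow_eq_pow_iff_natCast, ← algEquiv_pow_apply_of_apply_eq_pow hσ,
    ← algEquiv_pow_apply_of_apply_eq_pow hσ]
  exact ⟨fun h => by rw [h], hζ.algEquiv_ext⟩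

theorem IsPrimitiveRoot.exists_algEquiv_eq_pow (hζ : IsPrimitiveRoot ζ p) {u : ℕ}
    (hu : IsPrimitiveRoot (u : ZMod p) (p - 1)) {σ : K ≃ₐ[ℚ] K} (hσ : σ ζ = ζ ^ u)
    (τ : K ≃ₐ[ℚ] K) : ∃ j, τ = σ ^ j := by
  have hp := (Fact.out : p.Prime)
  have : NeZero p := ⟨hp.ne_zero⟩
  have : NeZero (p - 1) := ⟨by have := hp.two_le; omega⟩
  obtain ⟨k, -, hk⟩ := hζ.eq_pow_of_pow_eq_one (ξ := τ ζ) (by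
    rw [← map_pow, hζ.pow_eq_one, map_one])
  have hk0 : (k : ZMod p) ≠ 0 := by
    intro h
    rw [← Nat.cast_zero, ← hζ.pow_eq_pow_iff_natCast, hk, pow_zero, ← map_one τ] at h
    exact hζ.ne_one hp.one_lt (τ.injective h)
  obtain ⟨j, -, hj⟩ := hu.eq_pow_of_pow_eq_one (ZMod.pow_card_sub_one_eq_one hk0)
  refine ⟨j, hζ.algEquiv_ext ?_⟩
  rw [algEquiv_pow_apply_of_apply_eq_pow hσ, ← hk, hζ.pow_eq_pow_iff_natCast, ← hj, Nat.cast_pow]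

theorem IsPrimitiveRoot.algEquiv_eq_one_or_pow_half (hζ : IsPrimitiveRoot ζ p) (hp2 : p ≠ 2)
    {u : ℕ} (hu : IsPrimitiveRoot (u : ZMod p) (p - 1)) {σ : K ≃ₐ[ℚ] K} (hσ : σ ζ = ζ ^ u)
    {τ : K ≃ₐ[ℚ] K} (h : τ ζ = ζ ∨ τ ζ = ζ⁻¹) : τ = 1 ∨ τ = σ ^ ((p - 1) / 2) := by
  rcases h with h | h
  · exact .inl (hζ.algEquiv_ext (by simpa using h))
  · exact .inr (hζ.algEquiv_ext (by rw [h, hζ.algEquiv_pow_half_apply hp2 hu hσ]))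

/-- Galois correspondence: an automorphism fixing `ζ + ζ⁻¹` must send `ζ` to a root of `(T - ζ) * (T
- ζ⁻¹)`. -/
theorem mem_realSubfield_iff (hζ : IsPrimitiveRoot ζ p) (hp2 : p ≠ 2) {u : ℕ}
    (hu : IsPrimitiveRoot (u : ZMod p) (p - 1)) {σ : K ≃ₐ[ℚ] K} (hσ : σ ζ = ζ ^ u) (x : K) :
    x ∈ RealSubfield ζ ↔ (σ ^ ((p - 1) / 2)) x = x := by
  have : IsAbelianGalois ℚ K := IsCyclotomicExtension.isAbelianGalois {p} ℚ K
  have hc := hζ.algEquiv_pow_half_apply hp2 hu hσ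
  have hζ0 : ζ ≠ 0 := hζ.ne_zero (Fact.out : p.Prime).ne_zero
  set c := σ ^ ((p - 1) / 2)
  constructor
  · intro hx
    induction hx using IntermediateField.adjoin_induction with
    | mem y hy =>
      rw [Set.mem_singleton_iff.mp hy, map_add, map_inv₀, hc, inv_inv, add_comm]
    | algebraMap y => exact c.commutes y
    | add y z _ _ hy hz => rw [map_add, hy, hz]
    | inv y _ hy => rw [map_inv₀, hy]
    | mul y z _ _ hy hz => rw [map_mul, hy, hz]
  · intro hx
    rw [← IsGalois.fixedField_fixingSubgroup (RealSubfield ζ), IntermediateField.mem_fixedField_iff]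
    intro τ hτ
    rw [IntermediateField.mem_fixingSubgroup_iff] at hτ
    have h1 := hτ _ (IntermediateField.subset_adjoin ℚ _ (Set.mem_singleton (ζ + ζ⁻¹)))
    rw [map_add, map_inv₀] at h1
    have hτ0 : τ ζ ≠ 0 := by simpa using hζ0
    have h2 : (τ ζ - ζ) * (τ ζ - ζ⁻¹) = 0 := by
      field_simp at h1 ⊢
      linear_combination h1
    rcases hζ.algEquiv_eq_one_or_pow_half hp2 hu hσ
      ((mul_eq_zero.mp h2).imp sub_eq_zero.mp sub_eq_zero.mp) with rfl | rfl
    · rfl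
    · exact hx

end CyclotomicGalois

/-! ### A real unit with independent conjugates. -/

theorem ZMod.sum_range_natCast {n : ℕ} [NeZero n] {A : Type*} [AddCommMonoid A] (g : ZMod n → A) :
    ∑ i ∈ Finset.range n, g i = ∑ i, g i := by
  obtain ⟨k, rfl⟩ := Nat.exists_eq_succ_of_ne_zero (NeZero.ne n)
  rw [Finset.sum_range]
  exact Finset.sum_congr rfl fun i _ => congrArg g (Fin.cast_val_eq_self i)

/-- An integral unit which is rational has absolute value `1` at every place. -/
theorem NumberField.InfinitePlace.apply_eq_one_of_mem_bot {K : Type*} [Field K] [NumberField K]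
    (w : InfinitePlace K) (x : (𝓞 K)ˣ)
    (hx : algebraMap (𝓞 K) K x ∈ (⊥ : IntermediateField ℚ K)) :
    w (algebraMap (𝓞 K) K x) = 1 := by
  obtain ⟨q, hq⟩ := IntermediateField.mem_bot.mp hx
  have h := Units.norm K x
  rw [← hq, Algebra.norm_algebraMap, abs_pow,
    pow_eq_one_iff_of_nonneg (abs_nonneg q) Module.finrank_pos.ne'] at h
  rw [← hq, ← InfinitePlace.norm_embedding_eq]
  simp only [map_ratCast, eq_ratCast]
  rw [Complex.norm_ratCast]
  exact_mod_cast h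

section RealUnits

variable {p : ℕ} [Fact p.Prime] {K : Type*} [Field K] [NumberField K]
  [IsCyclotomicExtension {p} ℚ K] {ζ : K}

/-- The stabilizer of a place consists of the identity and complex conjugation, so the first `(p -
1) / 2` powers of `σ` move `w` to distinct places. -/
theorem NumberField.InfinitePlace.half_dvd_of_pow_smul_eq (hζ : IsPrimitiveRoot ζ p) (hp2 : p ≠ 2) {u : ℕ}
    (hu : IsPrimitiveRoot (u : ZMod p) (p - 1)) {σ : K ≃ₐ[ℚ] K} (hσ : σ ζ = ζ ^ u)
    (w : InfinitePlace K) (k : ℕ) (h : σ ^ k • w = w) : (p - 1) / 2 ∣ k := by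
  rw [← MulAction.mem_stabilizer_iff, ← InfinitePlace.mk_embedding w,
    InfinitePlace.mem_stabilizer_mk_iff] at h
  have hk : σ ^ k = 1 ∨ σ ^ k = σ ^ ((p - 1) / 2) := by
    refine hζ.algEquiv_eq_one_or_pow_half hp2 hu hσ (h.imp (fun h => by rw [h]; rfl) fun h => ?_)
    have h1 := h.eq ζ
    apply w.embedding.injective
    have hroot : w.embedding ζ ^ p = 1 := by rw [← map_pow, hζ.pow_eq_one, map_one]
    rw [map_inv₀, Complex.inv_eq_conj
      (Complex.norm_eq_one_of_pow_eq_one hroot (Fact.out : p.Prime).ne_zero)]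
    exact h1
  have hdvd : (p - 1) / 2 ∣ p - 1 := by
    have := (Fact.out : p.Prime).eq_two_or_odd'.resolve_left hp2
    exact Nat.div_dvd_of_dvd (by obtain ⟨k, hk⟩ := this; exact ⟨k, by omega⟩)
  rcases hk with hk | hk
  · rw [← pow_zero σ, hζ.algEquiv_pow_eq_pow_iff hu hσ] at hk
    exact (hk.dvd_iff hdvd).mpr (dvd_zero _)
  · rw [hζ.algEquiv_pow_eq_pow_iff hu hσ] at hk
    exact (hk.dvd_iff hdvd).mpr dvd_rfl

theorem exists_unit_realSubfield (hζ : IsPrimitiveRoot ζ p) (hp2 : p ≠ 2) {u : ℕ}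
    (hu : IsPrimitiveRoot (u : ZMod p) (p - 1)) {σ : K ≃ₐ[ℚ] K} (hσ : σ ζ = ζ ^ u)
    (x : K) (hx0 : x ≠ 0) (hx : IsIntegral ℤ x) (hx' : IsIntegral ℤ x⁻¹)
    (hfix : (σ ^ ((p - 1) / 2)) x = x) :
    ∃ y : (𝓞 (RealSubfield ζ))ˣ, algebraMap (𝓞 (RealSubfield ζ)) K y = x := by
  have hmem := (mem_realSubfield_iff hζ hp2 hu hσ x).mpr hfix
  let z : RealSubfield ζ := ⟨x, hmem⟩
  have hz : IsIntegral ℤ z :=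
    (isIntegral_algebraMap_iff (algebraMap (RealSubfield ζ) K).injective).mp hx
  have hz' : IsIntegral ℤ z⁻¹ := by
    rw [← isIntegral_algebraMap_iff (algebraMap (RealSubfield ζ) K).injective, map_inv₀]
    exact hx'
  have hz0 : z ≠ 0 := fun h => hx0 (congrArg Subtype.val h)
  refine ⟨⟨⟨z, hz⟩, ⟨z⁻¹, hz'⟩, ?_, ?_⟩, rfl⟩
  · ext1; exact mul_inv_cancel₀ hz0
  · ext1; exact inv_mul_cancel₀ hz0

/-- There is a unit of `K⁺` such that the only relations between its conjugates over `ℚ` are the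
powers of the norm relation. -/
theorem exists_unit_realSubfield_independent_conjugates (hζ : IsPrimitiveRoot ζ p) (hp2 : p ≠ 2)
    {u : ℕ} (hu : IsPrimitiveRoot (u : ZMod p) (p - 1)) {σ : K ≃ₐ[ℚ] K} (hσ : σ ζ = ζ ^ u) :
    ∃ v : (𝓞 (RealSubfield ζ))ˣ, ∀ c : ℕ → ℤ,
      ∏ i ∈ Finset.range ((p - 1) / 2),
        (σ ^ i) (algebraMap (𝓞 (RealSubfield ζ)) K v) ^ c i = 1 →
      ∀ i < (p - 1) / 2, ∀ j < (p - 1) / 2, c i = c j := by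
  have hp := (Fact.out : p.Prime)
  have : IsAbelianGalois ℚ K := IsCyclotomicExtension.isAbelianGalois {p} ℚ K
  set n := (p - 1) / 2 with hn
  have : NeZero n := ⟨by have := hp.two_le; omega⟩
  have hnn : n + n = p - 1 := by
    obtain ⟨k, hk⟩ := hp.eq_two_or_odd'.resolve_left hp2
    omega
  have hσ2 : σ ^ (n + n) = 1 := by
    rw [← pow_zero σ, hζ.algEquiv_pow_eq_pow_iff hu hσ, hnn]
    exact (Nat.modEq_zero_iff_dvd).mpr dvd_rfl
  let w : InfinitePlace K := Classical.arbitrary _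
  -- `e` has absolute value below `1` at every place other than `w`; multiplying it by its complex
  -- conjugate keeps this and makes it real.
  obtain ⟨e, he⟩ := Units.dirichletUnitTheorem.exists_unit K w
  let conjU : ℕ → (𝓞 K)ˣ := fun j =>
    Units.map (RingOfIntegers.mapRingHom (σ ^ j)).toMonoidHom e
  have hconjU : ∀ j, algebraMap (𝓞 K) K (conjU j) = (σ ^ j) (algebraMap (𝓞 K) K e) :=
    fun j => rfl
  let V : (𝓞 K)ˣ := e * conjU n
  set x : K := algebraMap (𝓞 K) K V with hx
  have hxe : x = algebraMap (𝓞 K) K e * (σ ^ n) (algebraMap (𝓞 K) K e) := by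
    rw [hx, ← hconjU, ← map_mul]; rfl
  have hx0 : x ≠ 0 := by simp [hx]
  have hfix : (σ ^ n) x = x := by
    rw [hxe, map_mul, ← AlgEquiv.mul_apply, ← pow_add, hσ2, AlgEquiv.one_apply, mul_comm]
  obtain ⟨v, hv⟩ := exists_unit_realSubfield hζ hp2 hu hσ x hx0 V.1.isIntegral_coe
    (by
      have : x⁻¹ = algebraMap (𝓞 K) K (V⁻¹ : (𝓞 K)ˣ) := by
        refine inv_eq_of_mul_eq_one_right ?_
        rw [hx, ← map_mul]; simp
      rw [this]; exact RingOfIntegers.isIntegral_coe _) hfix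
  refine ⟨v, ?_⟩
  rw [hv]
  have hσx0 : ∀ j, (σ ^ j) x ≠ 0 := fun j => (map_ne_zero _).mpr hx0
  have hlog0 : ∀ j, w ((σ ^ j) x) ≠ 0 := fun j => (map_ne_zero _).mpr (hσx0 j)
  have hfix' : ∀ q, ((σ ^ n) ^ q) x = x := by
    intro q
    induction q with
    | zero => rfl
    | succ q ih => rw [pow_succ, AlgEquiv.mul_apply, hfix, ih]
  have hper : ∀ j, (σ ^ (j % n)) x = (σ ^ j) x := by
    intro j
    conv_rhs => rw [← Nat.mod_add_div j n, pow_add, AlgEquiv.mul_apply, pow_mul, hfix']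
  let f : ZMod n → ℝ := fun j => Real.log (w ((σ ^ j.val) x))
  have hf : ∀ j : ℕ, f j = Real.log (w ((σ ^ j) x)) := fun j => by
    simp only [f, ZMod.val_natCast, hper]
  have hneg : ∀ k, ¬ n ∣ k → Real.log (w ((σ ^ k) (algebraMap (𝓞 K) K e))) < 0 := by
    intro k hk
    have h := he ((σ ^ k)⁻¹ • w) fun h => hk (by
      rw [inv_smul_eq_iff] at h
      exact InfinitePlace.half_dvd_of_pow_smul_eq hζ hp2 hu hσ w k h.symm)
    exact h
  have hfneg : ∀ i, i ≠ 0 → f i < 0 := by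
    intro i hi
    have hi' : ¬ n ∣ i.val := by rwa [← ZMod.natCast_eq_zero_iff, ZMod.natCast_zmod_val]
    have he0 : ∀ j, w ((σ ^ j) (algebraMap (𝓞 K) K e)) ≠ 0 := fun j =>
      (map_ne_zero _).mpr ((map_ne_zero _).mpr (by simp))
    simp only [f]
    rw [hxe, map_mul, ← AlgEquiv.mul_apply, ← pow_add, map_mul, Real.log_mul (he0 _) (he0 _)]
    exact add_neg (hneg _ hi') (hneg _ (by simpa using hi'))
  have hsum : ∑ i, f i = 0 := by
    rw [← ZMod.sum_range_natCast]
    simp only [hf]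
    rw [← Real.log_prod (fun i _ => hlog0 i), ← map_prod]
    -- `σ` permutes the factors cyclically, so the product is a rational unit and its logarithm
    -- vanishes.
    have hP : σ (∏ i ∈ Finset.range n, (σ ^ i) x) = ∏ i ∈ Finset.range n, (σ ^ i) x := by
      have h1 := Finset.prod_range_succ (fun i => (σ ^ i) x) n
      rw [Finset.prod_range_succ', hfix, pow_zero, AlgEquiv.one_apply] at h1
      rw [map_prod, ← mul_right_cancel₀ hx0 h1]
      exact Finset.prod_congr rfl fun i _ => by rw [pow_succ', AlgEquiv.mul_apply]
    have hbot : (∏ i ∈ Finset.range n, (σ ^ i) x) ∈ (⊥ : IntermediateField ℚ K) := by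
      rw [IsGalois.mem_bot_iff_fixed]
      intro τ
      obtain ⟨j, rfl⟩ := hζ.exists_algEquiv_eq_pow hu hσ τ
      induction j with
      | zero => rfl
      | succ j ih => rw [pow_succ, AlgEquiv.mul_apply, hP, ih]
    have hU : algebraMap (𝓞 K) K (∏ i ∈ Finset.range n,
        Units.map (RingOfIntegers.mapRingHom (σ ^ i)).toMonoidHom V : (𝓞 K)ˣ) =
        ∏ i ∈ Finset.range n, (σ ^ i) x := by
      rw [Units.coe_prod, map_prod]; rfl
    rw [← hU] at hbot ⊢
    rw [InfinitePlace.apply_eq_one_of_mem_bot w _ hbot, Real.log_one]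
  intro c hc
  -- Applying `log w ∘ σ ^ j` to the multiplicative relation gives one linear relation for each
  -- shift `j`.
  have key := eq_of_sum_mul_shift_eq_zero f hfneg hsum (fun i => (c i.val : ℝ)) (by
    intro j
    rw [← ZMod.sum_range_natCast]
    have h := congrArg (fun y => Real.log (w ((σ ^ j.val) y))) hc
    simp only [map_prod, map_zpow₀, map_one, Real.log_one] at h
    rw [Real.log_prod (fun i _ => zpow_ne_zero _
      ((map_ne_zero _).mpr ((map_ne_zero _).mpr (hσx0 i))))] at h
    rw [← h]
    refine Finset.sum_congr rfl fun i hi => ?_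
    rw [Real.log_zpow, ZMod.val_natCast, Nat.mod_eq_of_lt (Finset.mem_range.mp hi),
      ← AlgEquiv.mul_apply, ← pow_add, ← hf, Nat.cast_add, ZMod.natCast_zmod_val, add_comm j])
  intro i hi j hj
  have := key i j
  simp only [ZMod.val_natCast, Nat.mod_eq_of_lt hi, Nat.mod_eq_of_lt hj] at this
  exact_mod_cast this

end RealUnits

/-! ### Eigenunits modulo `p`-th powers. -/

section EigenUnit

variable {p : ℕ} [Fact p.Prime] {K : Type*} [Field K] [NumberField K]
  [IsCyclotomicExtension {p} ℚ K] {ζ : K}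

/-- If a unit of `K⁺` is a `p`-th power in `K`, then it is the `p`-th power of a unit of `K⁺`. -/
theorem exists_unit_pow_eq_of_pow_eq (hζ : IsPrimitiveRoot ζ p) (hp2 : p ≠ 2) {u : ℕ}
    (hu : IsPrimitiveRoot (u : ZMod p) (p - 1)) {σ : K ≃ₐ[ℚ] K} (hσ : σ ζ = ζ ^ u)
    (η : (𝓞 (RealSubfield ζ))ˣ) (x : K) (hx : x ^ p = algebraMap (𝓞 (RealSubfield ζ)) K η) :
    ∃ y : (𝓞 (RealSubfield ζ))ˣ, η = y ^ p := by
  have hp := (Fact.out : p.Prime)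
  have : NeZero p := ⟨hp.ne_zero⟩
  obtain ⟨n, hn⟩ := hp.eq_two_or_odd'.resolve_left hp2
  have hinj : Function.Injective (algebraMap (𝓞 (RealSubfield ζ)) K) :=
    FaithfulSMul.algebraMap_injective _ _
  have hη0 : algebraMap (𝓞 (RealSubfield ζ)) K η ≠ 0 := by
    rw [Ne, map_eq_zero_iff _ hinj]; exact η.ne_zero
  have hx0 : x ≠ 0 := by rintro rfl; rw [zero_pow hp.ne_zero] at hx; exact hη0 hx.symm
  have hζ0 : ζ ≠ 0 := hζ.ne_zero hp.ne_zero
  have hηfix := (mem_realSubfield_iff hζ hp2 hu hσ (algebraMap (𝓞 (RealSubfield ζ)) K η)).mp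
    (algebraMap (𝓞 (RealSubfield ζ)) (RealSubfield ζ) η).2
  have hc := hζ.algEquiv_pow_half_apply hp2 hu hσ
  have hreal : ∃ y : K, (σ ^ ((p - 1) / 2)) y = y ∧ y ^ p = algebraMap (𝓞 (RealSubfield ζ)) K η := by
    set c := σ ^ ((p - 1) / 2)
    obtain ⟨k, -, hk⟩ := hζ.eq_pow_of_pow_eq_one (ξ := c x * x⁻¹) (by
      rw [mul_pow, ← map_pow, hx, hηfix, inv_pow, hx, mul_inv_cancel₀ hη0])
    have hk' : c x = ζ ^ k * x := by rw [hk]; field_simp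
    have hpow : ζ ^ (2 * n + 1) = 1 := by rw [← hn]; exact hζ.pow_eq_one
    -- As `p = 2 * n + 1`, `n + 1` is the inverse of `2` modulo `p`: this twist shares the factor `ζ
    -- ^ k` evenly between `x` and its conjugate.
    refine ⟨ζ ^ ((n + 1) * k) * x, ?_, ?_⟩
    · rw [map_mul, map_pow, hc, hk', ← mul_assoc]
      congr 1
      rw [inv_pow, inv_mul_eq_iff_eq_mul₀ (pow_ne_zero _ hζ0), ← pow_add,
        show (n + 1) * k + (n + 1) * k = (2 * n + 1) * k + k by ring, pow_add, pow_mul, hpow,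
        one_pow, one_mul]
    · rw [mul_pow, hx, ← pow_mul, mul_comm, mul_comm _ p, pow_mul, hζ.pow_eq_one, one_pow, mul_one]
  obtain ⟨y, hyfix, hy⟩ := hreal
  have hy0 : y ≠ 0 := by rintro rfl; rw [zero_pow hp.ne_zero] at hy; exact hη0 hy.symm
  have hint : ∀ θ : (𝓞 (RealSubfield ζ))ˣ,
      IsIntegral ℤ (algebraMap (𝓞 (RealSubfield ζ)) K θ) := fun θ =>
    (θ.1.isIntegral_coe).map (IsScalarTower.toAlgHom ℤ (RealSubfield ζ) K)
  obtain ⟨z, hz⟩ := exists_unit_realSubfield hζ hp2 hu hσ y hy0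
    (IsIntegral.of_pow hp.pos (by rw [hy]; exact hint η))
    (IsIntegral.of_pow hp.pos (by
      rw [inv_pow, hy]
      have : (algebraMap (𝓞 (RealSubfield ζ)) K η)⁻¹ =
          algebraMap (𝓞 (RealSubfield ζ)) K (η⁻¹ : (𝓞 (RealSubfield ζ))ˣ) := by
        refine inv_eq_of_mul_eq_one_right ?_
        rw [← map_mul]; simp
      rw [this]; exact hint _)) hyfix
  refine ⟨z, Units.ext (hinj ?_)⟩
  rw [Units.val_pow_eq_pow_val, map_pow, hz, hy]

/-- Conjugation inverts powers of `ζ` but fixes `η`, so `η ^ 2 = 1`, and `p` is odd. -/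
theorem unit_realSubfield_eq_one_of_pow_eq_one (hζ : IsPrimitiveRoot ζ p) (hp2 : p ≠ 2) {u : ℕ}
    (hu : IsPrimitiveRoot (u : ZMod p) (p - 1)) {σ : K ≃ₐ[ℚ] K} (hσ : σ ζ = ζ ^ u)
    (η : (𝓞 (RealSubfield ζ))ˣ) (hη : η ^ p = 1) : η = 1 := by
  have hp := (Fact.out : p.Prime)
  have : NeZero p := ⟨hp.ne_zero⟩
  obtain ⟨n, hn⟩ := hp.eq_two_or_odd'.resolve_left hp2
  have hinj : Function.Injective (algebraMap (𝓞 (RealSubfield ζ)) K) :=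
    FaithfulSMul.algebraMap_injective _ _
  have hηfix := (mem_realSubfield_iff hζ hp2 hu hσ (algebraMap (𝓞 (RealSubfield ζ)) K η)).mp
    (algebraMap (𝓞 (RealSubfield ζ)) (RealSubfield ζ) η).2
  have hηp : (algebraMap (𝓞 (RealSubfield ζ)) K η) ^ p = 1 := by
    rw [← map_pow, ← Units.val_pow_eq_pow_val, hη]; simp
  have hζ0 : ζ ≠ 0 := hζ.ne_zero hp.ne_zero
  obtain ⟨k, -, hk⟩ := hζ.eq_pow_of_pow_eq_one hηp
  rw [← hk, map_pow, hζ.algEquiv_pow_half_apply hp2 hu hσ, inv_pow] at hηfix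
  have hsq := mul_inv_cancel₀ (pow_ne_zero k hζ0)
  rw [hηfix, ← pow_two] at hsq
  refine Units.ext (hinj ?_)
  rw [Units.val_one, map_one]
  have h2 : (algebraMap (𝓞 (RealSubfield ζ)) K η) ^ 2 = 1 := by rw [← hk, hsq]
  rw [hn, pow_succ, pow_mul, h2, one_pow, one_mul] at hηp
  exact hηp

theorem isSingular_iff_of_isUnit {K : Type*} [Field K] [NumberField K] {p : ℕ} {B : 𝓞 K}
    (hB : IsUnit B) : IsSingular p B ↔ ¬ ∃ x : K, x ^ p = (B : K) := by
  refine and_iff_left ⟨⊤, ?_⟩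
  rw [Ideal.span_singleton_eq_top.mpr hB, ← Ideal.one_eq_top, one_pow]

theorem exists_singular_eigenUnit (hζ : IsPrimitiveRoot ζ p)
    {u : ℕ} (hu : IsPrimitiveRoot (u : ZMod p) (p - 1)) {σ : K ≃ₐ[ℚ] K} (hσ : σ ζ = ζ ^ u)
    (m : ℕ) (hm : 1 ≤ m) (hmp : 2 * m + 3 ≤ p) :
    ∃ η : (𝓞 (RealSubfield ζ))ˣ,
      IsSingular p (algebraMap (𝓞 (RealSubfield ζ)) (𝓞 K) η) ∧
        IsEigenUnit p ζ σ (powResidue p u (2 * m)) η := by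
  have hp := (Fact.out : p.Prime)
  have hp2 : p ≠ 2 := by omega
  obtain ⟨n, hn⟩ := hp.eq_two_or_odd'.resolve_left hp2
  have hn2 : (p - 1) / 2 = n := by omega
  have : IsAbelianGalois ℚ K := IsCyclotomicExtension.isAbelianGalois {p} ℚ K
  have : IsAbelianGalois ℚ (RealSubfield ζ) := .tower_bot ℚ (RealSubfield ζ) K
  have hinj : Function.Injective (algebraMap (𝓞 (RealSubfield ζ)) K) :=
    FaithfulSMul.algebraMap_injective _ _
  let sU : (𝓞 (RealSubfield ζ))ˣ →* (𝓞 (RealSubfield ζ))ˣ :=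
    Units.map (RingOfIntegers.mapRingHom (σ.restrictNormal (RealSubfield ζ))).toMonoidHom
  have hsU : ∀ x : (𝓞 (RealSubfield ζ))ˣ, algebraMap (𝓞 (RealSubfield ζ)) K (sU x) =
      σ (algebraMap (𝓞 (RealSubfield ζ)) K x) := fun x =>
    σ.restrictNormal_commutes (RealSubfield ζ) (algebraMap (𝓞 (RealSubfield ζ)) _ x)
  let S : Module.End ℤ (Additive (𝓞 (RealSubfield ζ))ˣ) :=
    (MonoidHom.toAdditive sU).toIntLinearMap
  have hS1 : ∀ x, (S x).toMul = sU x.toMul := fun x => rfl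
  have hSpow : ∀ (j : ℕ) (x), algebraMap (𝓞 (RealSubfield ζ)) K ((S ^ j) x).toMul =
      (σ ^ j) (algebraMap (𝓞 (RealSubfield ζ)) K x.toMul) := by
    intro j x
    induction j with
    | zero => rfl
    | succ j ih => rw [pow_succ', pow_succ', Module.End.mul_apply, hS1, hsU, ih]; rfl
  have hcoe : ∀ x y : Additive (𝓞 (RealSubfield ζ))ˣ,
      algebraMap (𝓞 (RealSubfield ζ)) K x.toMul = algebraMap (𝓞 (RealSubfield ζ)) K y.toMul →
      x = y := fun x y h => Additive.toMul.injective (Units.ext (hinj h))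
  obtain ⟨v, hv⟩ := exists_unit_realSubfield_independent_conjugates hζ hp2 hu hσ
  have hμ : ((u ^ (2 * m) : ℕ) : ZMod p) ≠ 1 := by
    push_cast
    exact hu.pow_ne_one_of_pos_of_lt (by omega) (by omega)
  have hμcast : ((powResidue p u (2 * m) : ℕ) : ZMod p) = (u : ZMod p) ^ (2 * m) := by
    rw [powResidue, ZMod.natCast_mod, Nat.cast_pow]
  obtain ⟨x, hx, y, hxy⟩ := Module.End.exists_eigenvector_mod_prime hp
    (fun x hx => by
      refine Additive.toMul.injective
        (unit_realSubfield_eq_one_of_pow_eq_one hζ hp2 hu hσ x.toMul ?_)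
      rw [natCast_zsmul] at hx
      exact congrArg Additive.toMul hx)
    S (n := n) (by omega)
    (by
      refine LinearMap.ext fun x => hcoe _ _ ?_
      rw [hSpow, ← hn2, Module.End.one_apply]
      exact (mem_realSubfield_iff hζ hp2 hu hσ _).mp
        (algebraMap (𝓞 (RealSubfield ζ)) (RealSubfield ζ) x.toMul).2)
    (Additive.ofMul v)
    (by
      intro c hc
      rw [← hn2] at hc ⊢
      refine hv c ?_
      have h := congrArg (fun x : Additive (𝓞 (RealSubfield ζ))ˣ =>
        Units.map (algebraMap (𝓞 (RealSubfield ζ)) K).toMonoidHom x.toMul) hc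
      simp only [toMul_sum, toMul_zsmul, map_prod, map_zpow, toMul_zero, map_one] at h
      have h' := congrArg (Units.val) h
      rw [Units.coe_prod, Units.val_one] at h'
      rw [← h']
      refine Finset.prod_congr rfl fun i _ => ?_
      rw [Units.val_zpow_eq_zpow_val]
      exact congrArg (· ^ c i) (hSpow i (Additive.ofMul v)).symm)
    (powResidue p u (2 * m))
    -- `μ ^ n ≡ u ^ ((p - 1) * m) ≡ 1`: the even exponent `2 * m` is what makes `μ` an `n`-th root
    -- of unity.
    (by
      rw [← ZMod.intCast_zmod_eq_zero_iff_dvd]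
      push_cast
      rw [hμcast, ← pow_mul, show 2 * m * n = (p - 1) * m by rw [hn, Nat.add_sub_cancel]; ring,
        pow_mul, hu.pow_eq_one, one_pow, sub_self])
    (by
      rw [← ZMod.intCast_zmod_eq_zero_iff_dvd]
      push_cast
      rw [hμcast, sub_eq_zero]
      exact_mod_cast hμ)
  refine ⟨x.toMul, (isSingular_iff_of_isUnit (x.toMul.isUnit.map _)).mpr ?_, y.toMul, ?_⟩
  · rintro ⟨z, hz⟩
    obtain ⟨t, ht⟩ := exists_unit_pow_eq_of_pow_eq hζ hp2 hu hσ x.toMul z hz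
    refine hx ⟨Additive.ofMul t, Additive.toMul.injective ?_⟩
    rw [natCast_zsmul, toMul_nsmul, ht]; rfl
  · rw [← hsU, ← hS1, hxy, natCast_zsmul, natCast_zsmul]
    simp

end EigenUnit

/-! ### Congruences modulo powers of a prime element. -/

section Congruence

/-- If `x ≡ y` modulo a divisor `l` of the prime `p` with `l ^ (p - 1) ∣ p`, then
`x ^ p ≡ y ^ p` modulo `l ^ p`. -/
theorem pow_dvd_pow_sub_pow_of_dvd_sub {R : Type*} [CommRing R] {p : ℕ} (hp : p.Prime) {l : R}
    (hl : l ^ (p - 1) ∣ (p : R)) {x y : R} (h : l ∣ x - y) : l ^ p ∣ x ^ p - y ^ p := by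
  obtain ⟨z, hz⟩ := h
  obtain ⟨t, ht⟩ := hl
  -- The cross terms of the binomial expansion carry `p * l`, hence `l ^ p`.
  obtain ⟨r, hr⟩ := exists_add_pow_prime_eq hp y (l * z)
  obtain rfl : x = y + l * z := by rw [← hz]; ring
  obtain ⟨k, rfl⟩ := Nat.exists_eq_add_of_le' hp.one_le
  rw [Nat.add_sub_cancel] at ht
  rw [hr, ht]
  exact ⟨z ^ (k + 1) + t * y * z * r, by ring⟩

/-- Let `s` be an automorphism acting trivially modulo the prime `l` and by multiplication by `a`
on `l / l ^ 2`. If `s X ≡ X ^ k` modulo `l ^ (v + 1)` where `k ≢ a ^ v` modulo `l`, then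
`X ≡ 1` modulo `l ^ v` implies `X ≡ 1` modulo `l ^ (v + 1)`. -/
theorem pow_succ_dvd_sub_one_of_pow_dvd_sub_one {R : Type*} [CommRing R] [IsDomain R] {l : R}
    (hl : Prime l) (s : R →+* R) (hs : ∀ z, l ∣ s z - z) {w a : R} (hw : s l = l * w)
    (hwa : l ∣ w - a) {X : R} {k v : ℕ} (hv : 1 ≤ v) (hX : l ^ (v + 1) ∣ s X - X ^ k)
    (hk : ¬ l ∣ a ^ v - k) (h : l ^ v ∣ X - 1) : l ^ (v + 1) ∣ X - 1 := by
  obtain ⟨z, hz⟩ := h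
  obtain rfl : X = 1 + l ^ v * z := by rw [← hz]; ring
  -- The power is linear up to the square of `l ^ v * z`, and `2 * v ≥ v + 1`.
  have h1 : l ^ (v + 1) ∣ (1 + l ^ v * z) ^ k - (1 + k * (l ^ v * z)) := by
    have : (l ^ v * z) ^ 2 ∣ (1 + l ^ v * z) ^ k - (1 + k * (l ^ v * z)) := by
      clear hX hk
      induction k with
      | zero => simp
      | succ k ih =>
        obtain ⟨t, ht⟩ := ih
        refine ⟨t * (1 + l ^ v * z) + k, ?_⟩
        push_cast
        linear_combination (1 + l ^ v * z) * ht
    refine dvd_trans ?_ this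
    rw [mul_pow, ← pow_mul]
    exact (pow_dvd_pow l (by omega)).mul_right _
  have h2 : l ^ (v + 1) ∣ s (1 + l ^ v * z) - (1 + l ^ v * (a ^ v * z)) := by
    have : s (1 + l ^ v * z) - (1 + l ^ v * (a ^ v * z)) =
        l ^ v * (w ^ v * (s z - z) + (w ^ v - a ^ v) * z) := by
      rw [map_add, map_one, map_mul, map_pow, hw]; ring
    rw [this, pow_succ]
    exact mul_dvd_mul_left _ (dvd_add ((hs z).mul_left _)
      ((hwa.trans (sub_dvd_pow_sub_pow w a v)).mul_right _))
  -- Comparing the two linearizations leaves `l ∣ (a ^ v - k) * z`, which forces `l ∣ z`.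
  have h3 : l ^ v * l ∣ l ^ v * ((a ^ v - k) * z) := by
    rw [← pow_succ]
    have := dvd_add (dvd_sub hX h2) h1
    refine (this.trans (dvd_of_eq ?_))
    ring
  have h4 := (mul_dvd_mul_iff_left (pow_ne_zero v hl.ne_zero)).mp h3
  rw [add_sub_cancel_left, pow_succ]
  exact mul_dvd_mul_left _ ((hl.dvd_or_dvd h4).resolve_left hk)

end Congruence

/-! ### The `π`-adic valuation of `η ^ (p - 1) - 1`. -/

theorem exactlyDivides_primePi_iff {p : ℕ} [Fact p.Prime] [NeZero p] {K : Type*} [Field K]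
    [NumberField K] {ζ : K} (hζ : IsPrimitiveRoot ζ p) (n : ℕ) (x : 𝓞 K) :
    ExactlyDivides (primePi hζ) n x ↔
      (hζ.toInteger - 1) ^ n ∣ x ∧ ¬ (hζ.toInteger - 1) ^ (n + 1) ∣ x := by
  have h : primePi hζ = Ideal.span {hζ.toInteger - 1} := by
    rw [primePi, ← neg_sub, Ideal.span_singleton_neg]
  simp [ExactlyDivides, h, Ideal.span_singleton_pow, Ideal.mem_span_singleton]

section NonPrimary

variable {p : ℕ} [Fact p.Prime] {K : Type*} [Field K] [NumberField K]
  [IsCyclotomicExtension {p} ℚ K] {ζ : K}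

/-- The residue ring has prime order `p`, so `1` generates it additively. -/
theorem IsPrimitiveRoot.exists_int_toInteger_sub_one_dvd_sub [NeZero p] (hζ : IsPrimitiveRoot ζ p)
    (hp2 : p ≠ 2) (x : 𝓞 K) : ∃ c : ℤ, hζ.toInteger - 1 ∣ x - c := by
  have hp := (Fact.out : p.Prime)
  set I := Ideal.span {hζ.toInteger - 1} with hI
  have hcard : Nat.card (𝓞 K ⧸ I) = p := by
    rw [hζ.card_quotient_toInteger_sub_one, hζ.norm_toInteger_sub_one_of_prime_ne_two' hp2,
      Int.natAbs_natCast]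
  have hprime := hζ.zeta_sub_one_prime'
  have hI1 : I ≠ ⊤ := by
    rw [hI, Ne, Ideal.span_singleton_eq_top]; exact hprime.not_isUnit
  have hnt : Nontrivial (𝓞 K ⧸ I) := Ideal.Quotient.nontrivial_iff.mpr hI1
  obtain ⟨c, hc⟩ := AddSubgroup.mem_zmultiples_iff.mp
    (mem_zmultiples_of_prime_card (p := p) hcard (one_ne_zero (α := 𝓞 K ⧸ I))
      (g' := Ideal.Quotient.mk I x))
  refine ⟨c, ?_⟩
  rw [← Ideal.mem_span_singleton, ← hI, ← Ideal.Quotient.eq, ← hc]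
  simp

theorem exactlyDivides_of_not_isSingularPrimary (hζ : IsPrimitiveRoot ζ p)
    {u : ℕ} (hu : IsPrimitiveRoot (u : ZMod p) (p - 1)) {σ : K ≃ₐ[ℚ] K} (hσ : σ ζ = ζ ^ u)
    (m : ℕ) (hm : 1 ≤ m) (hmp : 2 * m + 3 ≤ p) (η ε : (𝓞 K)ˣ) (hη : IsSingular p (η : 𝓞 K))
    (hησ : RingOfIntegers.mapRingHom σ (η : 𝓞 K) =
      (η : 𝓞 K) ^ powResidue p u (2 * m) * (ε : 𝓞 K) ^ p)
    (hprim : ¬ IsSingularPrimary hζ (η : 𝓞 K)) :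
    ExactlyDivides (primePi hζ) (2 * m) ((η : 𝓞 K) ^ (p - 1) - 1) := by
  have hp := (Fact.out : p.Prime)
  have hp2 : p ≠ 2 := by omega
  have : NeZero p := ⟨hp.ne_zero⟩
  rw [exactlyDivides_primePi_iff]
  set l := hζ.toInteger - 1 with hl
  set s : 𝓞 K →+* 𝓞 K := RingOfIntegers.mapRingHom σ with hs_def
  set μ := powResidue p u (2 * m) with hμ
  have hprime : Prime l := hζ.zeta_sub_one_prime'
  have hdvdp : l ^ (p - 1) ∣ (p : 𝓞 K) :=
    (IsCyclotomicExtension.Rat.associated_zeta_sub_one_pow_prime p hζ).dvd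
  have hdvdint : ∀ n : ℤ, l ∣ (n : 𝓞 K) ↔ (p : ℤ) ∣ n := fun n =>
    IsCyclotomicExtension.Rat.zeta_sub_one_dvd_intCast_iff' p hζ
  have hrep := hζ.exists_int_toInteger_sub_one_dvd_sub hp2
  have hunit : ∀ (θ : (𝓞 K)ˣ) (c : ℤ), l ∣ (θ : 𝓞 K) - c → ¬ (p : ℤ) ∣ c := by
    intro θ c hc hpc
    rw [← hdvdint] at hpc
    exact hprime.not_isUnit (isUnit_of_dvd_unit ((dvd_sub_left hpc).mp hc) θ.isUnit)
  have hfermat : ∀ θ : (𝓞 K)ˣ, l ∣ (θ : 𝓞 K) ^ (p - 1) - 1 := by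
    intro θ
    obtain ⟨c, hc⟩ := hrep θ
    have h1 : l ∣ (c : 𝓞 K) ^ (p - 1) - 1 := by
      rw [← Int.cast_pow, ← Int.cast_one, ← Int.cast_sub, hdvdint]
      refine (Int.ModEq.pow_card_sub_one_eq_one hp ?_).symm.dvd
      exact (((Nat.prime_iff_prime_int.mp hp).coprime_iff_not_dvd).mpr (hunit θ c hc)).symm
    have := dvd_add (hc.trans (sub_dvd_pow_sub_pow _ _ (p - 1))) h1
    rwa [sub_add_sub_cancel] at this
  have hsζ : s hζ.toInteger = hζ.toInteger ^ u := by
    ext; exact hσ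
  have hsl : s l = l * ∑ i ∈ Finset.range u, hζ.toInteger ^ i := by
    rw [hl, map_sub, map_one, hsζ, mul_geom_sum]
  have hwu : l ∣ ∑ i ∈ Finset.range u, hζ.toInteger ^ i - (u : 𝓞 K) := by
    have : ∑ i ∈ Finset.range u, hζ.toInteger ^ i - (u : 𝓞 K) =
        ∑ i ∈ Finset.range u, (hζ.toInteger ^ i - 1) := by
      simp [Finset.sum_sub_distrib]
    rw [this]
    exact Finset.dvd_sum fun i _ => sub_one_dvd_pow_sub_one _ i
  have hs : ∀ z, l ∣ s z - z := by
    intro z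
    obtain ⟨c, t, ht⟩ := hrep z
    obtain rfl : z = c + l * t := by rw [← ht]; ring
    rw [map_add, map_mul, map_intCast, hsl]
    exact ⟨(∑ i ∈ Finset.range u, hζ.toInteger ^ i) * s t - t, by ring⟩
  set X := (η : 𝓞 K) ^ (p - 1) with hX
  have hsX : l ^ p ∣ s X - X ^ μ := by
    have h := pow_dvd_pow_sub_pow_of_dvd_sub hp hdvdp (hfermat ε)
    have : s X - X ^ μ = X ^ μ * ((((ε : 𝓞 K)) ^ (p - 1)) ^ p - 1 ^ p) := by
      rw [hX, map_pow, hησ]; ring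
    rw [this]
    exact h.mul_left _
  have hstep : ∀ v, 1 ≤ v → v < p → v ≠ 2 * m → l ^ v ∣ X - 1 → l ^ (v + 1) ∣ X - 1 := by
    intro v hv hvp hvm
    refine pow_succ_dvd_sub_one_of_pow_dvd_sub_one hprime s hs hsl hwu hv
      ((pow_dvd_pow l hvp).trans hsX) ?_
    intro h
    have h' : l ∣ (((u : ℤ) ^ v - μ : ℤ) : 𝓞 K) := by push_cast; exact h
    rw [hdvdint, ← ZMod.intCast_zmod_eq_zero_iff_dvd] at h'
    push_cast at h'
    rw [hμ, powResidue, ZMod.natCast_mod, Nat.cast_pow, sub_eq_zero] at h'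
    -- Exponents below `p - 1` are separated by the order of `u`; for `v = p - 1`, `u ^ v = 1`,
    -- which differs from `u ^ (2 * m)`.
    rcases lt_or_ge v (p - 1) with hv1 | hv1
    · exact hvm (hu.pow_inj hv1 (by omega) h')
    · rw [show v = p - 1 by omega, hu.pow_eq_one] at h'
      exact hu.pow_ne_one_of_pos_of_lt (by omega) (by omega) h'.symm
  constructor
  · have : ∀ v, 1 ≤ v → v ≤ 2 * m → l ^ v ∣ X - 1 := by
      intro v hv
      induction v, hv using Nat.le_induction with
      | base => intro _; rw [pow_one]; exact hfermat η
      | succ v hv ih => intro h; exact hstep v hv (by omega) (by omega) (ih (by omega))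
    exact this _ (by omega) le_rfl
  · intro h
    have hall : ∀ v, 2 * m + 1 ≤ v → v ≤ p → l ^ v ∣ X - 1 := by
      intro v hv
      induction v, hv using Nat.le_induction with
      | base => intro _; exact h
      | succ v hv ih => intro h; exact hstep v (by omega) (by omega) (by omega) (ih (by omega))
    have hXp := hall p (by omega) le_rfl
    obtain ⟨c, hc⟩ := hrep η
    refine hprim ⟨hη, c, hunit η c hc, ?_⟩
    have hπ : primePi hζ = Ideal.span {l} := by
      rw [primePi, hl, ← neg_sub, Ideal.span_singleton_neg]
    rw [hπ, Ideal.span_singleton_pow, Ideal.mem_span_singleton]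
    have h1 := pow_dvd_pow_sub_pow_of_dvd_sub hp hdvdp hc
    -- Subtracting `(X - 1) * η` from `η ^ p - c ^ p` leaves `η - c ^ p`.
    have h2 := dvd_sub h1 (hXp.mul_right (η : 𝓞 K))
    have hpow : (η : 𝓞 K) ^ p = X * η := by rw [hX, ← pow_succ, Nat.sub_add_cancel hp.one_le]
    rw [hpow] at h2
    convert h2 using 1
    ring

end NonPrimary

theorem theoremt610122 (p : ℕ) [Fact p.Prime] (K : Type*) [Field K] [NumberField K]
    [IsCyclotomicExtension {p} ℚ K] (ζ : K) (hζ : IsPrimitiveRoot ζ p)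
    (u : ℕ) (hu : IsPrimitiveRoot (u : ZMod p) (p - 1))
    (σ : K ≃ₐ[ℚ] K) (hσ : σ ζ = ζ ^ u)
    (m : ℕ) (hm : 1 ≤ m) (hmp : 2 * m + 3 ≤ p) :
    (∃ η : (𝓞 (RealSubfield ζ))ˣ,
      IsSingular p (algebraMap (𝓞 (RealSubfield ζ)) (𝓞 K) η) ∧
        IsEigenUnit p ζ σ (powResidue p u (2 * m)) η) ∧
    ∀ η : (𝓞 (RealSubfield ζ))ˣ,
      IsSingular p (algebraMap (𝓞 (RealSubfield ζ)) (𝓞 K) η) →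
      IsEigenUnit p ζ σ (powResidue p u (2 * m)) η →
      ¬ IsSingularPrimary hζ (algebraMap (𝓞 (RealSubfield ζ)) (𝓞 K) η) →
      ExactlyDivides (primePi hζ) (2 * m)
        (algebraMap (𝓞 (RealSubfield ζ)) (𝓞 K) η ^ (p - 1) - 1) := by
  refine ⟨exists_singular_eigenUnit hζ hu hσ m hm hmp, ?_⟩
  rintro η hη ⟨ε, hε⟩ hprim
  let ι := (Units.map (algebraMap (𝓞 (RealSubfield ζ)) (𝓞 K)).toMonoidHom)
  refine exactlyDivides_of_not_isSingularPrimary hζ hu hσ m hm hmp (ι η) (ι ε) hη ?_ hprim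
  ext
  exact hε
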